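/- Let $N\ge 0$ and $M$ be integers with $M=2N-1$ ($M$ odd) or $M=2N-2$ ($M$ even), and let $\alpha,\beta,\zeta_0,\lambda_1,\dots,\lambda_N\in\mathbb C$. On $\mathbb Z^{N+2}$, with coordinates $(n,m,l_1,\dots,l_N)$, put $s=n+m+l_1+\dots+l_N$ and $\zeta=\zeta_0+n\alpha+m\beta+l_1\lambda_1+\dots+l_N\lambda_N$, and let $\mathsf T_i$ be the shift $l_i\mapsto l_i+1$. Let $f$ be one of the functions $f(\xi)=\xi$ (equation $Q1^1$), $f(\xi)=\xi^2$ ($Q2$), $f(\xi)=\frac12(e^\xi+\delta^2e^{-\xi})$ with $\delta\in\{0,1\}$ ($Q3^\delta$), $f(\xi)=\sqrt k\,\mathrm{sn}(\xi)$ with modulus $k\in\mathbb C\setminus\{-1,0,1\}$ ($Q4$). The seed domain is the set of lattice points with $s\in\{N-1,\dots,M-N+2\}$; the band is the set of those with $s\in\{-N-1,\dots,M+N+2\}$. In the case of $Q4$ assume that $\zeta$ does not take a pole of $f$ as a value on the seed domain. Functions $u_I$, $I\subseteq\{1,\dots,N\}$, with values in $\mathbb C\cup\{\infty\}$ form an epitaxial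 sequence if each $u_I$ is defined where $s\in\{N-|I|-1,\dots,M-N+|I|+2\}$ and $$u_I=f\Big(\zeta+\sum_{i\in I}\lambda_i\Big)\ \text{ for } s\in\{N-|I|-1,N-|I|\},\qquad u_I=f\Big(\zeta-\sum_{i\in I}\lambda_i\Big)\ \text{ for } s\in\{M-N+|I|+1,M-N+|I|+2\}.$$ Let $\tau$ (with values in $\mathbb C$) and $u$ (with values in $\mathbb C\cup\{\infty\}$) be partially defined functions on $\mathbb Z^{N+2}$, and consider $$u_I=\frac{\big[\prod_{i\in I}(\mathsf T_i^{-1}-\mathsf T_i)\big](\tau u)}{\big[\prod_{i\in I}(\mathsf T_i^{-1}-\mathsf T_i)\big]\tau},\qquad I\subseteq\{1,\dots,N\}.\tag{1}$$ Here $\tau u$ is $0$ where $\tau=0$, whether or not $u$ is defined there; where $\tau\neq0$ it is defined if $u$ is defined and finite. An expression is defined at a point if all the values of $\tau$ and $\tau u$ that enter it are defined and the quotient is not $0/0$; the quotient is $\infty$ if only the denominator vanishes. Assume that $u$ is undefined off the seed domain or, more generally, only the following: for each $k\in\{1,\dots,N\}$, at every lattice point $q$ where $u$ is defined, (i) if $s(q)\in\{N-2k-1,N-2k\}$,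 then $u(q)\ne f(\zeta(q)+2\sum_{i\in J}\lambda_i)$ for at least one $J\subseteq\{1,\dots,N\}$ with $|J|=k$, and (ii) if $s(q)\in\{M-N+2k+1,M-N+2k+2\}$, then $u(q)\ne f(\zeta(q)-2\sum_{i\in J}\lambda_i)$ for at least one $J\subseteq\{1,\dots,N\}$ with $|J|=k$. Then (1) defines an epitaxial sequence if and only if 1. $u=f(\zeta)$ on the seed domain; 2. $\tau=0$ at all points of the band outside the seed domain, and $\tau$ is defined throughout the seed domain; 3. (non-degeneracy) the quotient (1) is not $0/0$ for any $I\subseteq\{1,\dots,N\}$ at any point with $s\in\{N-|I|-1,\dots,M-N+|I|+2\}$. -/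

import Mathlib

open scoped BigOperators UpperHalfPlane

noncomputable section

namespace SingularStrip

/-! ### The four type-Q equations and their functions `f` -/

/-- Theta constant `θ₂(0)` with nome `exp (π i ω)`. -/
def theta2 (ω : ℍ) : ℂ :=
  Complex.exp (Real.pi * Complex.I * (ω : ℂ) / 4) * jacobiTheta₂ ((ω : ℂ) / 2) ω

/-- Theta constant `θ₃(0)` with nome `exp (π i ω)`. -/
def theta3 (ω : ℍ) : ℂ := jacobiTheta₂ 0 ω

/-- The theta function `θ₁(π z) = 2 ∑_{n ≥ 0} (-1)ⁿ q^((n+1/2)²) sin((2n+1) π z)`,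
`q = exp (π i ω)`. -/
def theta1 (ω : ℍ) (z : ℂ) : ℂ :=
  -Complex.I * Complex.exp (Real.pi * Complex.I * (ω : ℂ) / 4 + Real.pi * Complex.I * z) *
    jacobiTheta₂ (z + 1 / 2 + (ω : ℂ) / 2) ω

/-- The theta function `θ₄(π z) = ∑_n (-1)ⁿ q^(n²) exp(2 π i n z)`, `q = exp (π i ω)`. -/
def theta4 (ω : ℍ) (z : ℂ) : ℂ := jacobiTheta₂ (z + 1 / 2) ω

/-- The square root `√k = θ₂ / θ₃` of the modulus `k = θ₂² / θ₃²` belonging to the period ratio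
`ω = i K' / K`. As `ω` runs through the upper half plane, `√k` runs through all the complex
numbers whose fourth power is neither `0` nor `1`, that is, `k` takes all values in
`ℂ \ {-1, 0, 1}`, each with both its square roots. -/
def sqrtModulus (ω : ℍ) : ℂ := theta2 ω / theta3 ω

/-- The Jacobi function `sn(ξ)` of modulus `k = θ₂² / θ₃²`, with values in `ℂ ∪ {∞}`:
`sn(ξ) = (θ₃ / θ₂) θ₁(ξ / θ₃²) / θ₄(ξ / θ₃²)`. -/
def jacobiSn (ω : ℍ) (ξ : ℂ) : OnePoint ℂ :=
  let z : ℂ := ξ / (Real.pi * theta3 ω ^ 2)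
  if theta4 ω z = 0 then OnePoint.infty
  else (((theta3 ω / theta2 ω) * (theta1 ω z / theta4 ω z) : ℂ) : OnePoint ℂ)

/-- The equations `Q1¹`, `Q2`, `Q3^δ` (`δ ∈ {0, 1}`) and `Q4` (with its elliptic modulus,
given through the period ratio). -/
inductive TypeQ where
  | Q1 : TypeQ
  | Q2 : TypeQ
  | Q3 (δ : Fin 2) : TypeQ
  | Q4 (ω : ℍ) : TypeQ

/-- The function `f` associated with each of the equations; it has poles only for `Q4`. -/
def TypeQ.f : TypeQ → ℂ → OnePoint ℂ
  | .Q1, ξ => (ξ : OnePoint ℂ)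
  | .Q2, ξ => ((ξ ^ 2 : ℂ) : OnePoint ℂ)
  | .Q3 δ, ξ =>
      ((1 / 2 * (Complex.exp ξ + ((δ : ℕ) : ℂ) ^ 2 * Complex.exp (-ξ)) : ℂ) : OnePoint ℂ)
  | .Q4 ω, ξ => OnePoint.map (fun s => sqrtModulus ω * s) (jacobiSn ω ξ)

/-! ### The lattice -/

/-- The lattice `ℤ^(N+2)` with coordinates `(n, m, l₁, …, l_N)`. -/
abbrev LatticePoint (N : ℕ) := ℤ × ℤ × (Fin N → ℤ)

/-- The unit vector in the direction of `l_i`. -/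
def dir {N : ℕ} (i : Fin N) : LatticePoint N := (0, 0, Pi.single i 1)

/-- `n + m + l₁ + … + l_N`. -/
def level {N : ℕ} (p : LatticePoint N) : ℤ := p.1 + p.2.1 + ∑ i, p.2.2 i

/-- `ζ = ζ₀ + n α + m β + l₁ λ₁ + … + l_N λ_N`. -/
def zeta {N : ℕ} (ζ₀ α β : ℂ) (lam : Fin N → ℂ) (p : LatticePoint N) : ℂ :=
  ζ₀ + p.1 * α + p.2.1 * β + ∑ i, (p.2.2 i : ℂ) * lam i

/-- The relation between the number `M` of degrees of freedom and the length `N` of the chain. -/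
def Dof (M : ℤ) (N : ℕ) : Prop :=
  (Odd M → M = 2 * N - 1) ∧ (Even M → M = 2 * N - 2)

/-- The strip on which the function `u_I` of an epitaxial sequence is defined. -/
def strip (M : ℤ) {N : ℕ} (I : Finset (Fin N)) : Set (LatticePoint N) :=
  {p | level p ∈ Set.Icc ((N : ℤ) - I.card - 1) (M - N + I.card + 2)}

/-- The seed domain. -/
def seedDomain (M : ℤ) (N : ℕ) : Set (LatticePoint N) :=
  {p | level p ∈ Set.Icc ((N : ℤ) - 1) (M - N + 2)}

/-- The band of all lattice points that participate in the problem. -/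
def band (M : ℤ) (N : ℕ) : Set (LatticePoint N) :=
  {p | level p ∈ Set.Icc (-(N : ℤ) - 1) (M + N + 2)}

/-! ### Epitaxial sequences -/

/-- `U I p` is the value of `u_I` at `p`, or `none` if `u_I` is not defined at `p`. -/
structure IsEpitaxial (E : TypeQ) (M : ℤ) {N : ℕ} (ζ₀ α β : ℂ) (lam : Fin N → ℂ)
    (U : Finset (Fin N) → LatticePoint N → Option (OnePoint ℂ)) : Prop where
  defined : ∀ I, ∀ p ∈ strip M I, (U I p).isSome
  lower : ∀ I, ∀ p, level p = N - I.card - 1 ∨ level p = N - I.card →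
    U I p = some (E.f (zeta ζ₀ α β lam p + ∑ i ∈ I, lam i))
  upper : ∀ I, ∀ p, level p = M - N + I.card + 1 ∨ level p = M - N + I.card + 2 →
    U I p = some (E.f (zeta ζ₀ α β lam p - ∑ i ∈ I, lam i))

/-! ### The expression for `u_I` -/

/-- The operator `T_i⁻¹ - T_i` on partially defined functions: the result is defined at `p` if
the function is defined at both `p - e_i` and `p + e_i`. -/
def diff {N : ℕ} (i : Fin N) : Function.End (LatticePoint N → Option ℂ) :=
  fun g p => Option.map₂ (fun a b => a - b) (g (p - dir i)) (g (p + dir i))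

theorem diff_commute {N : ℕ} (i j : Fin N) : Commute (diff i) (diff j) := by
  funext g p
  show diff i (diff j g) p = diff j (diff i g) p
  have h1 : p - dir i - dir j = p - dir j - dir i := by abel
  have h2 : p - dir i + dir j = p + dir j - dir i := by abel
  have h3 : p + dir i - dir j = p - dir j + dir i := by abel
  have h4 : p + dir i + dir j = p + dir j + dir i := by abel
  simp only [diff, h1, h2, h3, h4]
  rcases g (p - dir j - dir i) with _ | a <;> rcases g (p + dir j - dir i) with _ | b <;>
    rcases g (p - dir j + dir i) with _ | c <;> rcases g (p + dir j + dir i) with _ | d <;>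
    simp [Option.map₂]
  ring

theorem diff_pairwise {N : ℕ} (I : Finset (Fin N)) :
    (I : Set (Fin N)).Pairwise (Function.onFun Commute diff) :=
  fun i _ j _ _ => diff_commute i j

/-- The operator `∏_{i ∈ I} (T_i⁻¹ - T_i)` on partially defined functions. -/
def diffProd {N : ℕ} (I : Finset (Fin N)) : Function.End (LatticePoint N → Option ℂ) :=
  I.noncommProd diff (diff_pairwise I)

/-- The product `τ u` of a partially defined complex function `τ` and a partially defined
function `u` with values in `ℂ ∪ {∞}`: it is `0` where `τ = 0`, whether or not `u` is defined
there; where `τ ≠ 0` it is defined if `u` is defined and finite. -/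
def tauMul {N : ℕ} (τ : LatticePoint N → Option ℂ) (u : LatticePoint N → Option (OnePoint ℂ)) :
    LatticePoint N → Option ℂ :=
  fun q => (τ q).bind fun t =>
    if t = 0 then some 0
    else (u q).bind fun v => v.elim none (fun z : ℂ => some (t * z))

/-- The quotient `a / b` in `ℂ ∪ {∞}`, not defined for `0 / 0`. -/
def quotient : Option ℂ → Option ℂ → Option (OnePoint ℂ)
  | some a, some b =>
      if b = 0 then (if a = 0 then none else some OnePoint.infty)
      else some ((a / b : ℂ) : OnePoint ℂ)
  | _, _ => none

/-- `u_I = (∏_{i ∈ I} (T_i⁻¹ - T_i)) (τ u) / (∏_{i ∈ I} (T_i⁻¹ - T_i)) τ`. -/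
def chainFunction {N : ℕ} (τ : LatticePoint N → Option ℂ) (u : LatticePoint N → Option (OnePoint ℂ))
    (I : Finset (Fin N)) : LatticePoint N → Option (OnePoint ℂ) :=
  fun p => quotient (diffProd I (tauMul τ u) p) (diffProd I τ p)

/-- Nowhere on the strips does the expression for `u_I` become `0 / 0`. -/
def NeverIndeterminate (M : ℤ) {N : ℕ} (τ : LatticePoint N → Option ℂ)
    (u : LatticePoint N → Option (OnePoint ℂ)) : Prop :=
  ∀ I : Finset (Fin N), ∀ p ∈ strip M I,
    ¬ (diffProd I (tauMul τ u) p = some 0 ∧ diffProd I τ p = some 0)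

/-- `u` is not prescribed off the seed domain. The points of the band below (above) the seed domain
form pairs of layers numbered by `k = 1, …, N`; for `|J| = k` the expression for `u_J` on its lower
(upper) boundary involves `u` on the `k`-th pair of layers, with required boundary value
`f(ζ(q) ± 2 ∑_{i ∈ J} λ_i)` in terms of the point `q` of that layer. The condition is that at each
such `q` either `u` is undefined, or `u(q)` differs from this required value for at least one `J`.
It holds for every `u` that is undefined off the seed domain (`freeOffSeed_of_undefined`). -/
def FreeOffSeed (E : TypeQ) (M : ℤ) {N : ℕ} (ζ₀ α β : ℂ) (lam : Fin N → ℂ)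
    (u : LatticePoint N → Option (OnePoint ℂ)) : Prop :=
  (∀ q, ∀ k : ℕ, 1 ≤ k → k ≤ N →
    level q = N - 2 * k - 1 ∨ level q = N - 2 * k → ∀ v, u q = some v →
    ∃ J : Finset (Fin N), J.card = k ∧ v ≠ E.f (zeta ζ₀ α β lam q + 2 * ∑ i ∈ J, lam i)) ∧
  (∀ q, ∀ k : ℕ, 1 ≤ k → k ≤ N →
    level q = M - N + 2 * k + 1 ∨ level q = M - N + 2 * k + 2 → ∀ v, u q = some v →
    ∃ J : Finset (Fin N), J.card = k ∧ v ≠ E.f (zeta ζ₀ α β lam q - 2 * ∑ i ∈ J, lam i))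

theorem freeOffSeed_of_undefined (E : TypeQ) (M : ℤ) {N : ℕ} (ζ₀ α β : ℂ) (lam : Fin N → ℂ)
    (u : LatticePoint N → Option (OnePoint ℂ)) (hu : ∀ q, q ∉ seedDomain M N → u q = none) :
    FreeOffSeed E M ζ₀ α β lam u := by
  constructor
  · intro q k hk hkN hq v hv
    rw [hu q (by simp only [seedDomain, Set.mem_ofPred_eq, Set.mem_Icc]; omega)] at hv
    cases hv
  · intro q k hk hkN hq v hv
    rw [hu q (by simp only [seedDomain, Set.mem_ofPred_eq, Set.mem_Icc]; omega)] at hv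
    cases hv

end SingularStrip

end

/-! The expression for `u_I` at `q + dirSum I` combines the values at the corners `q + 2 • dirSum
K`, `K ⊆ I`, with signs `(-1)^|K|`. On the lower boundary of the strip of `u_I` the top corner lies
in the seed domain and all others lie below it; on the upper boundary the bottom corner lies in the
seed domain and all others lie above it. If `τ` vanishes off the seed domain, a single corner
survives, its factor `±τ` cancels, and what remains is the seed value of `f`, which is the required
boundary value (`isEpitaxial_of_seed`).

Conversely, `I = ∅` gives `u = f(ζ)` and `τ ≠ 0` on the seed domain (`IsEpitaxial.seed`). Moving
away from it by pairs of layers, induction on the number `k` of the pair kills all corners of a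
`k`-cube except its two ends. The seed end already has the required value, so `τ(q) ≠ 0` at the
other end would force `u(q)` to have it as well, for every `J` with `|J| = k`. `FreeOffSeed`
excludes this. -/

namespace SingularStrip

/-! ### Level and `ζ` along sums of unit vectors -/

variable {N : ℕ}

/-- The sum of the unit vectors in the directions `i ∈ I`. -/
def dirSum (I : Finset (Fin N)) : LatticePoint N := ∑ i ∈ I, dir i

theorem dirSum_insert {i : Fin N} {I : Finset (Fin N)} (hi : i ∉ I) :
    dirSum (insert i I) = dir i + dirSum I := Finset.sum_insert hi

theorem level_add (p q : LatticePoint N) : level (p + q) = level p + level q := by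
  simp only [level, Prod.fst_add, Prod.snd_add, Pi.add_apply, Finset.sum_add_distrib]
  ring

theorem level_dir (i : Fin N) : level (dir i) = 1 := by
  simp [level, dir]

theorem level_dirSum (I : Finset (Fin N)) : level (dirSum I) = I.card := by
  induction I using Finset.induction_on with
  | empty => simp [dirSum, level]
  | insert i I hi ih =>
    rw [dirSum_insert hi, level_add, level_dir, ih, Finset.card_insert_of_notMem hi]
    push_cast
    ring

theorem level_add_dirSum (q : LatticePoint N) (I : Finset (Fin N)) :
    level (q + dirSum I) = level q + I.card := by
  rw [level_add, level_dirSum]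

theorem level_add_two_dirSum (q : LatticePoint N) (I : Finset (Fin N)) :
    level (q + 2 • dirSum I) = level q + 2 * I.card := by
  rw [two_nsmul, level_add, level_add, level_dirSum]
  ring

theorem zeta_add (ζ₀ α β : ℂ) (lam : Fin N → ℂ) (p q : LatticePoint N) :
    zeta ζ₀ α β lam (p + q) = zeta ζ₀ α β lam p + zeta 0 α β lam q := by
  simp only [zeta, Prod.fst_add, Prod.snd_add, Pi.add_apply, Int.cast_add, add_mul,
    Finset.sum_add_distrib]
  ring

theorem zeta_dir (α β : ℂ) (lam : Fin N → ℂ) (i : Fin N) : zeta 0 α β lam (dir i) = lam i := by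
  simp [zeta, dir, Pi.single_apply]

theorem zeta_dirSum (α β : ℂ) (lam : Fin N → ℂ) (I : Finset (Fin N)) :
    zeta 0 α β lam (dirSum I) = ∑ i ∈ I, lam i := by
  induction I using Finset.induction_on with
  | empty => simp [dirSum, zeta]
  | insert i I hi ih => rw [dirSum_insert hi, zeta_add, zeta_dir, ih, Finset.sum_insert hi]

theorem zeta_add_dirSum (ζ₀ α β : ℂ) (lam : Fin N → ℂ) (q : LatticePoint N)
    (I : Finset (Fin N)) :
    zeta ζ₀ α β lam (q + dirSum I) = zeta ζ₀ α β lam q + ∑ i ∈ I, lam i := by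
  rw [zeta_add, zeta_dirSum]

theorem zeta_add_two_dirSum (ζ₀ α β : ℂ) (lam : Fin N → ℂ) (q : LatticePoint N)
    (I : Finset (Fin N)) :
    zeta ζ₀ α β lam (q + 2 • dirSum I) = zeta ζ₀ α β lam q + 2 * ∑ i ∈ I, lam i := by
  rw [two_nsmul, ← add_assoc, zeta_add_dirSum, zeta_add_dirSum]
  ring

/-! ### Products of difference operators -/

theorem diffProd_empty (g : LatticePoint N → Option ℂ) : diffProd ∅ g = g := by
  rw [diffProd, Finset.noncommProd_empty]
  rfl

theorem diffProd_insert {i : Fin N} {I : Finset (Fin N)} (hi : i ∉ I)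
    (g : LatticePoint N → Option ℂ) (p : LatticePoint N) :
    diffProd (insert i I) g p =
      Option.map₂ (fun a b => a - b) (diffProd I g (p - dir i)) (diffProd I g (p + dir i)) := by
  rw [diffProd, Finset.noncommProd_insert_of_notMem _ _ _ _ hi]
  rfl

/-- Expanding the product, `K` collects the directions in which `-T_i` is chosen. Centring at `q +
dirSum I` makes `q` the lowest corner. The total function `h` has to match `g` at the corners only.
-/
theorem diffProd_eq_some_sum (I : Finset (Fin N)) (g : LatticePoint N → Option ℂ)
    (h : LatticePoint N → ℂ) (q : LatticePoint N)
    (hg : ∀ K ⊆ I, g (q + 2 • dirSum K) = some (h (q + 2 • dirSum K))) :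
    diffProd I g (q + dirSum I) =
      some (∑ K ∈ I.powerset, (-1) ^ K.card * h (q + 2 • dirSum K)) := by
  induction I using Finset.induction_on generalizing q with
  | empty => simpa [diffProd_empty, dirSum] using hg ∅ (by simp)
  | insert i I hi ih =>
    have e : ∀ K ⊆ I, q + 2 • dirSum (insert i K) = q + 2 • dir i + 2 • dirSum K := by
      intro K hK
      rw [dirSum_insert (fun h' => hi (hK h'))]
      abel
    have e₁ : q + dirSum (insert i I) - dir i = q + dirSum I := by
      rw [dirSum_insert hi]; abel
    have e₂ : q + dirSum (insert i I) + dir i = q + 2 • dir i + dirSum I := by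
      rw [dirSum_insert hi]; abel
    rw [diffProd_insert hi, e₁, e₂, ih q fun K hK => hg K (hK.trans (Finset.subset_insert i I)),
      ih (q + 2 • dir i) fun K hK => by
        rw [← e K hK]; exact hg _ (Finset.insert_subset_insert i hK),
      Finset.sum_powerset_insert hi, Option.map₂_some_some, sub_eq_add_neg,
      ← Finset.sum_neg_distrib]
    congr 2
    refine Finset.sum_congr rfl fun K hK => ?_
    have hK' := Finset.mem_powerset.1 hK
    rw [e K hK', Finset.card_insert_of_notMem (fun h' => hi (hK' h'))]
    ring

/-- Every corner enters the expression, and an undefined value never cancels. This is how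
definedness of `u_I` passes to `τ` and `τ u`. -/
theorem isSome_of_isSome_diffProd (I : Finset (Fin N)) (g : LatticePoint N → Option ℂ)
    (q : LatticePoint N) (hg : (diffProd I g (q + dirSum I)).isSome) :
    ∀ K ⊆ I, (g (q + 2 • dirSum K)).isSome := by
  induction I using Finset.induction_on generalizing q with
  | empty =>
    intro K hK
    rw [Finset.subset_empty.1 hK]
    simpa [diffProd_empty, dirSum] using hg
  | insert i I hi ih =>
    intro K hK
    have e₁ : q + dirSum (insert i I) - dir i = q + dirSum I := by
      rw [dirSum_insert hi]; abel
    have e₂ : q + dirSum (insert i I) + dir i = q + 2 • dir i + dirSum I := by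
      rw [dirSum_insert hi]; abel
    rw [diffProd_insert hi, e₁, e₂] at hg
    obtain ⟨c, hc⟩ := Option.isSome_iff_exists.1 hg
    obtain ⟨a, b, ha, hb, -⟩ := Option.map₂_eq_some_iff.1 hc
    by_cases hiK : i ∈ K
    · have e : q + 2 • dirSum K = q + 2 • dir i + 2 • dirSum (K.erase i) := by
        conv_lhs => rw [← Finset.insert_erase hiK, dirSum_insert (Finset.notMem_erase i K)]
        abel
      rw [e]
      exact ih _ (by simp [-nsmul_eq_mul, Option.mem_def.1 hb]) _ (Finset.subset_insert_iff.1 hK)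
    · exact ih _ (by simp [-nsmul_eq_mul, Option.mem_def.1 ha]) _
        ((Finset.subset_insert_iff_of_notMem hiK).1 hK)

theorem diffProd_isSome (I : Finset (Fin N)) (g : LatticePoint N → Option ℂ)
    (q : LatticePoint N) (hg : ∀ K ⊆ I, (g (q + 2 • dirSum K)).isSome) :
    (diffProd I g (q + dirSum I)).isSome := by
  -- The default `0` is never used at a corner.
  rw [diffProd_eq_some_sum I g (fun p => (g p).getD 0) q fun K hK => by
    obtain ⟨a, ha⟩ := Option.isSome_iff_exists.1 (hg K hK)
    simp [-nsmul_eq_mul, ha]]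
  rfl

/-- If `g` vanishes at all the corners of a cube but the highest one, only this corner contributes
to the iterated difference. -/
theorem diffProd_of_top (I : Finset (Fin N)) (g : LatticePoint N → Option ℂ)
    (q : LatticePoint N) (b : ℂ) (hb : g (q + 2 • dirSum I) = some b)
    (hg : ∀ K ⊆ I, K ≠ I → g (q + 2 • dirSum K) = some 0) :
    diffProd I g (q + dirSum I) = some ((-1) ^ I.card * b) := by
  rw [diffProd_eq_some_sum I g (fun p => (g p).getD 0) q fun K hK => by
    by_cases h : K = I
    · simp [-nsmul_eq_mul, h, hb]
    · simp [-nsmul_eq_mul, hg K hK h]]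
  rw [Finset.sum_eq_single I]
  · simp [-nsmul_eq_mul, hb]
  · intro K hK h
    simp [-nsmul_eq_mul, hg K (Finset.mem_powerset.1 hK) h]
  · simp

/-- If `g` vanishes at all the corners of a cube but the lowest and the highest one, only these
two contribute to the iterated difference. -/
theorem diffProd_of_ends {I : Finset (Fin N)} (hI : I.Nonempty) (g : LatticePoint N → Option ℂ)
    (q : LatticePoint N) (a b : ℂ) (ha : g q = some a) (hb : g (q + 2 • dirSum I) = some b)
    (hg : ∀ K ⊆ I, K.Nonempty → K ≠ I → g (q + 2 • dirSum K) = some 0) :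
    diffProd I g (q + dirSum I) = some (a + (-1) ^ I.card * b) := by
  have ha' : g (q + 2 • dirSum ∅) = some a := by simpa [dirSum] using ha
  rw [diffProd_eq_some_sum I g (fun p => (g p).getD 0) q fun K hK => by
    by_cases h : K = I
    · simp [-nsmul_eq_mul, h, hb]
    · rcases K.eq_empty_or_nonempty with rfl | h'
      · simp [-nsmul_eq_mul, ha']
      · simp [-nsmul_eq_mul, hg K hK h' h]]
  rw [Finset.sum_eq_add_of_mem ∅ I (Finset.empty_mem_powerset I) (Finset.mem_powerset_self I)
    hI.ne_empty.symm]
  · simp [-nsmul_eq_mul, ha', hb]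
  · intro K hK h
    simp [-nsmul_eq_mul, hg K (Finset.mem_powerset.1 hK) (Finset.nonempty_iff_ne_empty.2 h.1) h.2]

/-- If `g` vanishes at all the corners of a cube but the lowest one, only this corner contributes
to the iterated difference. -/
theorem diffProd_of_bottom (I : Finset (Fin N)) (g : LatticePoint N → Option ℂ)
    (q : LatticePoint N) (a : ℂ) (ha : g q = some a)
    (hg : ∀ K ⊆ I, K.Nonempty → g (q + 2 • dirSum K) = some 0) :
    diffProd I g (q + dirSum I) = some a := by
  rcases I.eq_empty_or_nonempty with rfl | hI
  · simpa [diffProd_empty, dirSum] using ha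
  · simpa using diffProd_of_ends hI g q a 0 ha (hg I subset_rfl hI) fun K hK h _ => hg K hK h

/-! ### The product `τ u` and the quotient -/

variable {τ : LatticePoint N → Option ℂ} {u : LatticePoint N → Option (OnePoint ℂ)}

theorem tauMul_of_zero {q : LatticePoint N} (h : τ q = some 0) : tauMul τ u q = some 0 := by
  simp [tauMul, h]

theorem tauMul_of_coe {q : LatticePoint N} {t z : ℂ} (h : τ q = some t)
    (hz : u q = some (z : OnePoint ℂ)) : tauMul τ u q = some (t * z) := by
  by_cases ht : t = 0
  · simp [tauMul, h, ht]
  · simp [tauMul, h, ht, hz]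

theorem exists_coe_of_tauMul_isSome {q : LatticePoint N} {t : ℂ} (h : τ q = some t) (ht : t ≠ 0)
    (hq : (tauMul τ u q).isSome) : ∃ z : ℂ, u q = some (z : OnePoint ℂ) := by
  rcases hv : u q with _ | v
  · simp [tauMul, h, ht, hv] at hq
  · induction v using OnePoint.rec with
    | infty => simp [tauMul, h, ht, hv] at hq
    | coe z => exact ⟨z, rfl⟩

theorem quotient_mul_self {c z : ℂ} (hc : c ≠ 0) :
    quotient (some (c * z)) (some c) = some (z : OnePoint ℂ) := by
  simp [quotient, hc]

theorem quotient_eq_some_coe {a b z : ℂ}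
    (h : quotient (some a) (some b) = some (z : OnePoint ℂ)) : b ≠ 0 ∧ a = b * z := by
  unfold quotient at h
  by_cases hb : b = 0
  · by_cases ha : a = 0 <;> simp [ha, hb] at h
  · simp only [hb, if_false, Option.some.injEq, OnePoint.coe_eq_coe] at h
    exact ⟨hb, by rw [← h]; field_simp⟩

theorem isSome_of_quotient_isSome {a b : Option ℂ} (h : (quotient a b).isSome) :
    a.isSome ∧ b.isSome := by
  rcases a with _ | a <;> rcases b with _ | b <;> simp_all [quotient]

theorem quotient_isSome {a b : Option ℂ} (ha : a.isSome) (hb : b.isSome)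
    (h : ¬ (a = some 0 ∧ b = some 0)) : (quotient a b).isSome := by
  rcases a with _ | a <;> rcases b with _ | b <;> simp_all [quotient]
  split_ifs <;> simp_all

theorem quotient_zero_zero : quotient (some 0) (some 0) = none := by
  simp [quotient]

theorem exists_coe_of_ne_infty {v : OnePoint ℂ} (h : v ≠ OnePoint.infty) :
    ∃ z : ℂ, v = z := (OnePoint.ne_infty_iff_exists.1 h).imp fun _ h => h.symm

theorem exists_eq_add_dirSum (I : Finset (Fin N)) (p : LatticePoint N) :
    ∃ q, p = q + dirSum I := ⟨p - dirSum I, by abel⟩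

theorem Dof.eq_or_eq {M : ℤ} (h : Dof M N) : M = 2 * N - 1 ∨ M = 2 * N - 2 :=
  (Int.even_or_odd M).elim (fun h' => Or.inr (h.2 h')) fun h' => Or.inl (h.1 h')

/-! ### The characterization of epitaxial sequences -/

section

variable {E : TypeQ} {M : ℤ} {ζ₀ α β : ℂ} {lam : Fin N → ℂ}

/-! ### Sufficiency of the conditions -/

theorem isEpitaxial_of_seed (hMN : Dof M N)
    (hpole : ∀ p ∈ seedDomain M N, E.f (zeta ζ₀ α β lam p) ≠ OnePoint.infty)
    (hu : ∀ p ∈ seedDomain M N, u p = some (E.f (zeta ζ₀ α β lam p)))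
    (hτ₀ : ∀ p ∈ band M N \ seedDomain M N, τ p = some 0)
    (hτ : ∀ p ∈ seedDomain M N, (τ p).isSome) (hnd : NeverIndeterminate M τ u) :
    IsEpitaxial E M ζ₀ α β lam (chainFunction τ u) := by
  have hM := hMN.eq_or_eq
  have hseed : ∀ p ∈ seedDomain M N, ∃ t z : ℂ, τ p = some t ∧
      tauMul τ u p = some (t * z) ∧ E.f (zeta ζ₀ α β lam p) = z := by
    intro p hp
    obtain ⟨t, ht⟩ := Option.isSome_iff_exists.1 (hτ p hp)
    obtain ⟨z, hz⟩ := exists_coe_of_ne_infty (hpole p hp)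
    exact ⟨t, z, ht, tauMul_of_coe ht (by rw [hu p hp, hz]), hz⟩
  have hband : ∀ p ∈ band M N, (τ p).isSome ∧ (tauMul τ u p).isSome := by
    intro p hp
    by_cases hs : p ∈ seedDomain M N
    · obtain ⟨t, z, ht, htz, -⟩ := hseed p hs
      simp [ht, htz]
    · have h0 := hτ₀ p ⟨hp, hs⟩
      simp [h0, tauMul_of_zero h0]
  have hoff : ∀ p, (-(N : ℤ) - 1 ≤ level p ∧ level p < N - 1) ∨
      (M - N + 2 < level p ∧ level p ≤ M + N + 2) → τ p = some 0 := by
    intro p hp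
    refine hτ₀ p ⟨?_, ?_⟩ <;> simp only [band, seedDomain, Set.mem_ofPred_eq, Set.mem_Icc] <;> omega
  refine ⟨fun I p hp => ?_, fun I p hp => ?_, fun I p hp => ?_⟩
  · obtain ⟨q, rfl⟩ := exists_eq_add_dirSum I p
    have hI : I.card ≤ N := by simpa using I.card_le_univ
    have hK : ∀ K ⊆ I, q + 2 • dirSum K ∈ band M N := by
      intro K hK
      have := Finset.card_le_card hK
      simp only [strip, band, Set.mem_ofPred_eq, Set.mem_Icc, level_add_two_dirSum,
        level_add_dirSum] at hp ⊢
      omega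
    exact quotient_isSome (diffProd_isSome I _ q fun K h => (hband _ (hK K h)).2)
      (diffProd_isSome I _ q fun K h => (hband _ (hK K h)).1) (hnd I _ hp)
  · have hI : I.card ≤ N := by simpa using I.card_le_univ
    have hst : p ∈ strip M I := by
      simp only [strip, Set.mem_ofPred_eq, Set.mem_Icc]
      omega
    obtain ⟨q, rfl⟩ := exists_eq_add_dirSum I p
    rw [level_add_dirSum] at hp
    obtain ⟨t, z, ht, htz, hz⟩ := hseed (q + 2 • dirSum I) (by
      simp only [seedDomain, Set.mem_ofPred_eq, Set.mem_Icc, level_add_two_dirSum]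
      omega)
    have h0 : ∀ K ⊆ I, K ≠ I → τ (q + 2 • dirSum K) = some 0 := by
      intro K hK hne
      have := Finset.card_lt_card (Finset.ssubset_iff_subset_ne.2 ⟨hK, hne⟩)
      refine hoff _ ?_
      rw [level_add_two_dirSum]
      omega
    have h₁ := diffProd_of_top I τ q t ht h0
    have h₂ := diffProd_of_top I (tauMul τ u) q (t * z) htz
      fun K hK hne => tauMul_of_zero (h0 K hK hne)
    -- The surviving corner is the only contribution to the denominator, so `t = 0` would give `0 /
    -- 0`.
    have ht0 : t ≠ 0 := by
      rintro rfl
      exact hnd I _ hst ⟨by simpa using h₂, by simpa using h₁⟩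
    rw [← zeta_add_dirSum, add_assoc, ← two_nsmul, hz, chainFunction, h₁, h₂, ← mul_assoc]
    exact quotient_mul_self (mul_ne_zero (by simp) ht0)
  · have hI : I.card ≤ N := by simpa using I.card_le_univ
    have hst : p ∈ strip M I := by
      simp only [strip, Set.mem_ofPred_eq, Set.mem_Icc]
      omega
    obtain ⟨q, rfl⟩ := exists_eq_add_dirSum I p
    rw [level_add_dirSum] at hp
    obtain ⟨t, z, ht, htz, hz⟩ := hseed q (by
      simp only [seedDomain, Set.mem_ofPred_eq, Set.mem_Icc]
      omega)
    have h0 : ∀ K ⊆ I, K.Nonempty → τ (q + 2 • dirSum K) = some 0 := by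
      intro K hK hne
      have := Finset.card_le_card hK
      have := hne.card_pos
      refine hoff _ ?_
      rw [level_add_two_dirSum]
      omega
    have h₁ := diffProd_of_bottom I τ q t ht h0
    have h₂ := diffProd_of_bottom I (tauMul τ u) q (t * z) htz
      fun K hK hne => tauMul_of_zero (h0 K hK hne)
    have ht0 : t ≠ 0 := by
      rintro rfl
      exact hnd I _ hst ⟨by simpa using h₂, h₁⟩
    rw [zeta_add_dirSum, add_sub_cancel_right, hz, chainFunction, h₁, h₂]
    exact quotient_mul_self ht0

/-! ### Necessity of the conditions -/

theorem IsEpitaxial.neverIndeterminate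
    (h : IsEpitaxial E M ζ₀ α β lam (chainFunction τ u)) : NeverIndeterminate M τ u := by
  rintro I p hp ⟨h₁, h₂⟩
  have := h.defined I p hp
  rw [chainFunction, h₁, h₂, quotient_zero_zero] at this
  cases this

theorem IsEpitaxial.seed (h : IsEpitaxial E M ζ₀ α β lam (chainFunction τ u)) (hMN : Dof M N)
    {p : LatticePoint N} (hp : p ∈ seedDomain M N) :
    ∃ t : ℂ, t ≠ 0 ∧ τ p = some t ∧ u p = some (E.f (zeta ζ₀ α β lam p)) := by
  have hM := hMN.eq_or_eq
  simp only [seedDomain, Set.mem_ofPred_eq, Set.mem_Icc] at hp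
  have hval : quotient (tauMul τ u p) (τ p) = some (E.f (zeta ζ₀ α β lam p)) := by
    -- Both boundary conditions on `u_∅` are needed: for odd `M` the seed domain has a third layer,
    -- `N + 1 = M - N + 2`, reached only by the upper one.
    by_cases hl : level p = N - 1 ∨ level p = N
    · simpa [chainFunction, diffProd_empty] using h.lower ∅ p (by simpa using hl)
    · simpa [chainFunction, diffProd_empty] using h.upper ∅ p
        (by simp only [Finset.card_empty, Nat.cast_zero]; omega)
  obtain ⟨h₁, h₂⟩ := isSome_of_quotient_isSome (by rw [hval]; rfl)
  obtain ⟨t, ht⟩ := Option.isSome_iff_exists.1 h₂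
  have ht0 : t ≠ 0 := by
    rintro rfl
    rw [tauMul_of_zero ht, ht, quotient_zero_zero] at hval
    cases hval
  obtain ⟨z, hz⟩ := exists_coe_of_tauMul_isSome ht ht0 h₁
  refine ⟨t, ht0, ht, ?_⟩
  rw [tauMul_of_coe ht hz, ht, quotient_mul_self ht0] at hval
  rw [hz, hval]

/-- The boundary condition on `u_I`, when `τ` vanishes at the corners of the cube other than its
ends, forces the values of `u` at both ends to agree if `τ` vanishes at neither of them. -/
theorem eq_of_chainFunction_eq {I : Finset (Fin N)} (hI : I.Nonempty) {q : LatticePoint N}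
    {t t' z z' w : ℂ} (ht : τ q = some t) (hz : u q = some (z : OnePoint ℂ))
    (ht' : τ (q + 2 • dirSum I) = some t')
    (hz' : u (q + 2 • dirSum I) = some (z' : OnePoint ℂ))
    (h0 : ∀ K ⊆ I, K.Nonempty → K ≠ I → τ (q + 2 • dirSum K) = some 0)
    (hw : chainFunction τ u I (q + dirSum I) = some (w : OnePoint ℂ)) :
    t * (z - w) + (-1) ^ I.card * t' * (z' - w) = 0 := by
  rw [chainFunction, diffProd_of_ends hI τ q t t' ht ht' h0,
    diffProd_of_ends hI (tauMul τ u) q _ _ (tauMul_of_coe ht hz) (tauMul_of_coe ht' hz')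
      fun K hK hne hne' => tauMul_of_zero (h0 K hK hne hne')] at hw
  linear_combination (quotient_eq_some_coe hw).2

/-- Strong induction on the distance `k` from the seed domain, using the lower boundary condition on
`u_J`, `|J| = k`, at `q + dirSum J`. -/
theorem IsEpitaxial.eq_zero_below (h : IsEpitaxial E M ζ₀ α β lam (chainFunction τ u))
    (hMN : Dof M N)
    (hpole : ∀ p ∈ seedDomain M N, E.f (zeta ζ₀ α β lam p) ≠ OnePoint.infty)
    (hu : FreeOffSeed E M ζ₀ α β lam u) (k : ℕ) (hk : 1 ≤ k) (hkN : k ≤ N) (q : LatticePoint N)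
    (hq : level q = N - 2 * k - 1 ∨ level q = N - 2 * k) : τ q = some 0 := by
  have hM := hMN.eq_or_eq
  induction k using Nat.strong_induction_on generalizing q with
  | h k ih =>
    have hdef : ∀ J : Finset (Fin N), J.card = k →
        (tauMul τ u q).isSome ∧ (τ q).isSome := by
      intro J hJ
      have h₁ := isSome_of_quotient_isSome (h.defined J (q + dirSum J) (by
        simp only [strip, Set.mem_ofPred_eq, Set.mem_Icc, level_add_dirSum]
        omega))
      have e : q + 2 • dirSum (∅ : Finset (Fin N)) = q := by simp [dirSum]
      have h₂ := isSome_of_isSome_diffProd J _ q h₁.1 ∅ (Finset.empty_subset J)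
      have h₃ := isSome_of_isSome_diffProd J _ q h₁.2 ∅ (Finset.empty_subset J)
      rw [e] at h₂ h₃
      exact ⟨h₂, h₃⟩
    -- Any `J₀` of size `k` shows that `τ` and `τ u` are defined at `q`. The `J` from `FreeOffSeed`
    -- depends on the value `u(q)` and is available only afterwards.
    obtain ⟨J₀, -, hJ₀⟩ := Finset.exists_subset_card_eq (s := (Finset.univ : Finset (Fin N)))
      (n := k) (by simpa using hkN)
    obtain ⟨htu, hts⟩ := hdef J₀ hJ₀
    obtain ⟨t, ht⟩ := Option.isSome_iff_exists.1 hts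
    by_contra hne
    have ht0 : t ≠ 0 := fun h' => hne (by rw [ht, h'])
    obtain ⟨z, hz⟩ := exists_coe_of_tauMul_isSome ht ht0 htu
    obtain ⟨J, hJ, hJz⟩ := hu.1 q k hk hkN hq _ hz
    apply hJz
    have hs : q + 2 • dirSum J ∈ seedDomain M N := by
      simp only [seedDomain, Set.mem_ofPred_eq, Set.mem_Icc, level_add_two_dirSum]
      omega
    obtain ⟨t', -, ht', hut'⟩ := h.seed hMN hs
    obtain ⟨w, hw⟩ := exists_coe_of_ne_infty (hpole _ hs)
    have hval := h.lower J (q + dirSum J) (by rw [level_add_dirSum]; omega)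
    rw [← zeta_add_dirSum, add_assoc, ← two_nsmul, hw] at hval
    have := eq_of_chainFunction_eq (Finset.card_pos.1 (by omega)) ht hz ht' (by rw [hut', hw])
      (fun K hK hK₁ hK₂ => by
        have := Finset.card_lt_card (Finset.ssubset_iff_subset_ne.2 ⟨hK, hK₂⟩)
        have := hK₁.card_pos
        -- Each direction in `K` climbs two levels, that is, one pair of layers towards the seed
        -- domain.
        exact ih (k - K.card) (by omega) (by omega) (by omega) _
          (by rw [level_add_two_dirSum]; omega)) hval
    rw [← zeta_add_two_dirSum, hw]
    simpa [ht0, sub_eq_zero] using this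

/-- Mirror image of `IsEpitaxial.eq_zero_below`: `q` is now the top corner and the seed point `r`
the bottom one, so the corner belonging to `K` lies in pair number `|K|`. -/
theorem IsEpitaxial.eq_zero_above (h : IsEpitaxial E M ζ₀ α β lam (chainFunction τ u))
    (hMN : Dof M N)
    (hpole : ∀ p ∈ seedDomain M N, E.f (zeta ζ₀ α β lam p) ≠ OnePoint.infty)
    (hu : FreeOffSeed E M ζ₀ α β lam u) (k : ℕ) (hk : 1 ≤ k) (hkN : k ≤ N) (q : LatticePoint N)
    (hq : level q = M - N + 2 * k + 1 ∨ level q = M - N + 2 * k + 2) : τ q = some 0 := by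
  have hM := hMN.eq_or_eq
  induction k using Nat.strong_induction_on generalizing q with
  | h k ih =>
    have hbase : ∀ J : Finset (Fin N), ∃ r, q = r + 2 • dirSum J :=
      fun J => ⟨q - 2 • dirSum J, by abel⟩
    have hdef : ∀ J : Finset (Fin N), J.card = k →
        (tauMul τ u q).isSome ∧ (τ q).isSome := by
      intro J hJ
      obtain ⟨r, rfl⟩ := hbase J
      rw [level_add_two_dirSum] at hq
      have h₁ := isSome_of_quotient_isSome (h.defined J (r + dirSum J) (by
        simp only [strip, Set.mem_ofPred_eq, Set.mem_Icc, level_add_dirSum]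
        omega))
      exact ⟨isSome_of_isSome_diffProd J _ r h₁.1 J subset_rfl,
        isSome_of_isSome_diffProd J _ r h₁.2 J subset_rfl⟩
    obtain ⟨J₀, -, hJ₀⟩ := Finset.exists_subset_card_eq (s := (Finset.univ : Finset (Fin N)))
      (n := k) (by simpa using hkN)
    obtain ⟨htu, hts⟩ := hdef J₀ hJ₀
    obtain ⟨t, ht⟩ := Option.isSome_iff_exists.1 hts
    by_contra hne
    have ht0 : t ≠ 0 := fun h' => hne (by rw [ht, h'])
    obtain ⟨z, hz⟩ := exists_coe_of_tauMul_isSome ht ht0 htu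
    obtain ⟨J, hJ, hJz⟩ := hu.2 q k hk hkN hq _ hz
    apply hJz
    obtain ⟨r, rfl⟩ := hbase J
    rw [level_add_two_dirSum] at hq
    have hs : r ∈ seedDomain M N := by
      simp only [seedDomain, Set.mem_ofPred_eq, Set.mem_Icc]
      omega
    obtain ⟨t', -, ht', hut'⟩ := h.seed hMN hs
    obtain ⟨w, hw⟩ := exists_coe_of_ne_infty (hpole _ hs)
    have hval := h.upper J (r + dirSum J) (by rw [level_add_dirSum]; omega)
    rw [zeta_add_dirSum, add_sub_cancel_right, hw] at hval
    have := eq_of_chainFunction_eq (Finset.card_pos.1 (by omega)) ht' (by rw [hut', hw]) ht hz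
      (fun K hK hK₁ hK₂ => by
        have := Finset.card_lt_card (Finset.ssubset_iff_subset_ne.2 ⟨hK, hK₂⟩)
        have := hK₁.card_pos
        exact ih K.card (by omega) (by omega) (by omega) _
          (by rw [level_add_two_dirSum]; omega)) hval
    rw [zeta_add_two_dirSum, add_sub_cancel_right, hw]
    simpa [ht0, sub_eq_zero] using this

theorem IsEpitaxial.eq_zero_off_seed (h : IsEpitaxial E M ζ₀ α β lam (chainFunction τ u))
    (hMN : Dof M N)
    (hpole : ∀ p ∈ seedDomain M N, E.f (zeta ζ₀ α β lam p) ≠ OnePoint.infty)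
    (hu : FreeOffSeed E M ζ₀ α β lam u) {q : LatticePoint N}
    (hq : q ∈ band M N \ seedDomain M N) : τ q = some 0 := by
  have hM := hMN.eq_or_eq
  simp only [Set.mem_sdiff, band, seedDomain, Set.mem_ofPred_eq, Set.mem_Icc] at hq
  by_cases hl : level q < N - 1
  -- Integer division by two sends both layers of a pair to its number `k`.
  · exact h.eq_zero_below hMN hpole hu ((N - level q) / 2).toNat (by omega) (by omega) q
      (by omega)
  · exact h.eq_zero_above hMN hpole hu ((level q - (M - N + 1)) / 2).toNat (by omega) (by omega) q
      (by omega)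

end

end SingularStrip

theorem mainTheorem3 (E : SingularStrip.TypeQ) (M : ℤ) (N : ℕ) (hMN : SingularStrip.Dof M N)
    (ζ₀ α β : ℂ) (lam : Fin N → ℂ)
    (hpole : ∀ p ∈ SingularStrip.seedDomain M N,
      E.f (SingularStrip.zeta ζ₀ α β lam p) ≠ OnePoint.infty)
    (τ : SingularStrip.LatticePoint N → Option ℂ)
    (u : SingularStrip.LatticePoint N → Option (OnePoint ℂ))
    (hu : SingularStrip.FreeOffSeed E M ζ₀ α β lam u) :
    SingularStrip.IsEpitaxial E M ζ₀ α β lam (SingularStrip.chainFunction τ u) ↔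
      (∀ p ∈ SingularStrip.seedDomain M N,
        u p = some (E.f (SingularStrip.zeta ζ₀ α β lam p))) ∧
      (∀ p ∈ SingularStrip.band M N \ SingularStrip.seedDomain M N, τ p = some 0) ∧
      (∀ p ∈ SingularStrip.seedDomain M N, (τ p).isSome) ∧
      SingularStrip.NeverIndeterminate M τ u := by
  refine ⟨fun h => ⟨fun p hp => ?_, fun p hp => h.eq_zero_off_seed hMN hpole hu hp,
    fun p hp => ?_, h.neverIndeterminate⟩, fun ⟨h₁, h₂, h₃, h₄⟩ =>
    SingularStrip.isEpitaxial_of_seed hMN hpole h₁ h₂ h₃ h₄⟩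
  · obtain ⟨_, -, -, h'⟩ := h.seed hMN hp
    exact h'
  · obtain ⟨_, -, h', -⟩ := h.seed hMN hp
    simp [h']
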